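/- For complex $\nu$ and $z \in \mathbb{C} \setminus (-\infty, 0]$ let $$J_\nu(z) = \left(\tfrac{1}{2} z\right)^{\nu} \sum_{m=0}^{\infty} (-1)^m \frac{(\tfrac12 z)^{2m}}{\Gamma(\nu+m+1)\, m!}$$ be the Bessel function of the first kind of order $\nu$, where the power takes its principal value (and $1/\Gamma$ is $0$ at the poles of $\Gamma$). **Theorem.** For every complex order $\nu$, the difference $$\tfrac{1}{2} \pi t \left[ J_\nu(t)^2 + J_{\nu+1}(t)^2 \right] - 1$$ is $O(t^{-1})$ as the positive real $t$ tends to infinity (with implied constant allowed to depend on $\nu$). Consequently, for every complex $\nu$, Lommel's relation $$J_\nu(t)^2 + J_{\nu+1}(t)^2 \sim \frac{2}{\pi t}$$ holds as $t$ tends to infinity through positive real values, in the sense that the ratio of the two sides tends to $1$. -/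

import Mathlib

open Filter Topology Asymptotics

/-- The Bessel function of the first kind `J_ν` of complex order `ν`, given by
`(z/2)^ν * ∑_{m ≥ 0} (-1)^m (z/2)^(2m) / (Γ(ν + m + 1) m!)`, where the power takes its principal
value. It is meant for `z` in the plane cut along `(-∞, 0]`. Mathlib sets `Γ` to be `0` at its
poles and `x / 0 = 0`, which agrees with the usual convention `1 / Γ(-n) = 0`. -/
noncomputable def besselJ (ν z : ℂ) : ℂ :=
  (z / 2) ^ ν *
    ∑' m : ℕ, (-1) ^ m * ((z / 2) ^ (2 * m) / (Complex.Gamma (ν + m + 1) * (m.factorial : ℂ)))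

/-- The series defining `besselJ` converges absolutely. -/
theorem summable_besselJ (ν z : ℂ) :
    Summable fun m : ℕ =>
      (-1) ^ m * ((z / 2) ^ (2 * m) / (Complex.Gamma (ν + m + 1) * (m.factorial : ℂ))) := by
  obtain ⟨N, hN⟩ := exists_nat_gt ‖ν‖
  have hne : ∀ m : ℕ, N ≤ m → ν + m + 1 ≠ 0 ∧ Complex.Gamma (ν + m + 1) ≠ 0 := by
    intro m hm
    have key : ∀ k : ℕ, ν + m + 1 ≠ -(k : ℂ) := by
      intro k h
      have h1 : ν = -((m + 1 + k : ℕ) : ℂ) := by push_cast; linear_combination h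
      rw [h1, norm_neg, Complex.norm_natCast] at hN
      have : m + 1 + k < N := by exact_mod_cast hN
      omega
    exact ⟨by simpa using key 0, Complex.Gamma_ne_zero key⟩
  have hneg : ∀ m : ℕ, (-1 : ℂ) ^ m ≠ 0 := fun m => by simp
  generalize z / 2 = w
  by_cases hz : w = 0
  · subst hz
    refine summable_of_ne_finset_zero (s := {0}) ?_
    intro m hm
    have : m ≠ 0 := by simpa using hm
    simp [this]
  refine summable_of_ratio_test_tendsto_lt_one (l := 0) zero_lt_one ?_ ?_
  · filter_upwards [eventually_ge_atTop N] with m hm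
    have := (hne m hm).2
    have : (m.factorial : ℂ) ≠ 0 := by exact_mod_cast m.factorial_ne_zero
    exact mul_ne_zero (hneg m) (div_ne_zero (pow_ne_zero _ hz) (mul_ne_zero ‹_› ‹_›))
  · have hlim : Tendsto (fun m : ℕ => ‖w‖ ^ 2 / (m : ℝ)) atTop (𝓝 0) :=
      tendsto_const_div_atTop_nhds_zero_nat _
    refine squeeze_zero' (Eventually.of_forall fun m => by positivity) ?_ hlim
    filter_upwards [eventually_ge_atTop (N + 1)] with m hm
    obtain ⟨h1, h2⟩ := hne m (by omega)
    have h3 : (m.factorial : ℂ) ≠ 0 := by exact_mod_cast m.factorial_ne_zero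
    have h4 : (m : ℂ) + 1 ≠ 0 := by exact_mod_cast m.succ_ne_zero
    have hm0 : (0 : ℝ) < m := by exact_mod_cast (by omega : 0 < m)
    have hG : Complex.Gamma (ν + ((m + 1 : ℕ) : ℂ) + 1) =
        (ν + m + 1) * Complex.Gamma (ν + m + 1) := by
      rw [← Complex.Gamma_add_one _ h1]; push_cast; ring_nf
    have hA : (1 : ℝ) ≤ ‖ν + m + 1‖ := by
      have e : ((m + 1 : ℕ) : ℂ) = (ν + m + 1) - ν := by push_cast; ring
      have := norm_sub_le (ν + m + 1) ν
      rw [← e, Complex.norm_natCast] at this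
      have h5 : ((N + 1 : ℕ) : ℝ) ≤ m := by exact_mod_cast hm
      push_cast at this h5
      linarith
    have hB : (m : ℝ) ≤ ‖(m : ℂ) + 1‖ := by
      have : (m : ℂ) + 1 = ((m + 1 : ℕ) : ℂ) := by push_cast; ring
      rw [this, Complex.norm_natCast]; push_cast; linarith
    rw [← norm_div, hG, Nat.factorial_succ]
    have hq : ∀ G : ℂ, G ≠ 0 →
        (-1 : ℂ) ^ (m + 1) * ((w) ^ (2 * (m + 1)) /
          ((ν + m + 1) * G * (((m + 1) * m.factorial : ℕ) : ℂ))) /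
        ((-1) ^ m * ((w) ^ (2 * m) / (G * (m.factorial : ℂ)))) =
        -((w) ^ 2 / ((ν + m + 1) * ((m : ℂ) + 1))) := by
      intro G hG0
      have := hneg m
      push_cast
      field_simp
      ring
    rw [hq _ h2, norm_neg, norm_div, norm_mul, norm_pow]
    refine div_le_div_of_nonneg_left (by positivity) hm0 ?_
    nlinarith

/-! Everything rests on Hankel's asymptotics √t J_ν(t) = √(2/π) cos(t - πν/2 - π/4) + O(1/t),
`isBigO_besselJ_sub_cos`. Raising ν by one turns the cosine into a sine, and cos² + sin² = 1 also at
complex arguments, so squaring and adding gives Lommel's relation with its error term.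

For Re ν > 1/2, Poisson's integral writes J_ν as the integral of exp(its)(1 - s²)^(ν - 1/2) over
[-1, 1]. Cauchy's theorem moves the path to the other three sides of the rectangle [-1, 1] × [0, 1].
The top side is exponentially small; the vertical sides are Laplace integrals, whose leading terms
Watson's lemma supplies, and these two endpoint terms combine to the cosine.

Every other order is reached by descending with J_ν = (2(ν + 1)/t) J_(ν+1) - J_(ν+2): the middle
term is one power of t smaller, and the cosine changes sign when ν grows by two. -/

/-- The three-term recurrence of the Bessel functions in the order. -/
theorem besselJ_add_besselJ_add_two (ν : ℂ) {z : ℂ} (hz : z ≠ 0) :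
    besselJ ν z + besselJ (ν + 2) z = 2 * (ν + 1) / z * besselJ (ν + 1) z := by
  have hw : z / 2 ≠ 0 := div_ne_zero hz two_ne_zero
  have hS0 := summable_besselJ ν z
  have hS1 := summable_besselJ (ν + 1) z
  have hS2 := summable_besselJ (ν + 2) z
  have key : (∑' m : ℕ, (-1) ^ m * ((z / 2) ^ (2 * m) /
        (Complex.Gamma (ν + m + 1) * (m.factorial : ℂ)))) +
      (z / 2) ^ 2 * ∑' m : ℕ, (-1) ^ m * ((z / 2) ^ (2 * m) /
        (Complex.Gamma (ν + 2 + m + 1) * (m.factorial : ℂ))) =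
      (ν + 1) * ∑' m : ℕ, (-1) ^ m * ((z / 2) ^ (2 * m) /
        (Complex.Gamma (ν + 1 + m + 1) * (m.factorial : ℂ))) := by
    -- The factor (z/2)² aligns term m of order ν + 2 with term m + 1 of the other two series; their
    -- terms at 0 are matched separately. Working with 1/Γ keeps the identities valid at the poles.
    rw [← tsum_mul_left, ← tsum_mul_left, hS0.tsum_eq_zero_add,
      (hS1.mul_left (ν + 1)).tsum_eq_zero_add, add_assoc,
      ← ((summable_nat_add_iff 1).2 hS0).tsum_add (hS2.mul_left _)]
    congr 1
    · have h := Complex.one_div_Gamma_eq_self_mul_one_div_Gamma_add_one (ν + 1)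
      simp only [Nat.cast_zero, add_zero, mul_zero, pow_zero, Nat.factorial_zero, Nat.cast_one,
        mul_one, one_mul, one_div]
      exact h
    · refine tsum_congr fun m => ?_
      have h := Complex.one_div_Gamma_eq_self_mul_one_div_Gamma_add_one (ν + m + 2)
      have e1 : ν + ((m + 1 : ℕ) : ℂ) + 1 = ν + m + 2 := by push_cast; ring
      have e2 : ν + 2 + m + 1 = ν + m + 2 + 1 := by ring
      have e3 : ν + 1 + ((m + 1 : ℕ) : ℂ) + 1 = ν + m + 2 + 1 := by push_cast; ring
      have h3 : (m.factorial : ℂ) ≠ 0 := by exact_mod_cast m.factorial_ne_zero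
      have h4 : (m : ℂ) + 1 ≠ 0 := by exact_mod_cast m.succ_ne_zero
      rw [e1, e2, e3, Nat.factorial_succ]
      simp only [div_eq_mul_inv, mul_inv]
      rw [h]
      push_cast
      field_simp
      ring
  have e1 : (z / 2) ^ (ν + 1) = (z / 2) ^ ν * (z / 2) := by
    rw [Complex.cpow_add _ _ hw, Complex.cpow_one]
  have e2 : (z / 2) ^ (ν + 2) = (z / 2) ^ ν * (z / 2) ^ 2 := by
    rw [Complex.cpow_add _ _ hw]; norm_cast
  unfold besselJ
  rw [e1, e2]
  have h5 : 2 * (ν + 1) / z * ((z / 2) ^ ν * (z / 2)) = (z / 2) ^ ν * (ν + 1) := by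
    field_simp
  rw [← mul_assoc, h5, mul_assoc _ (ν + 1), ← key]
  ring

/-! ### Watson's lemma -/

/-- A quantitative form of Watson's lemma with one term. -/
theorem norm_cpow_mul_integral_exp_neg_sub_le {α : ℂ} (hα : 0 < α.re) {h : ℝ → ℂ}
    (hm : Measurable h) {c : ℂ} {K : ℝ} (hK : ∀ y, 0 < y → ‖h y - c‖ ≤ K * y) {t : ℝ}
    (ht : 0 < t) :
    ‖(t : ℂ) ^ α * (∫ y in Set.Ioi (0 : ℝ), (y : ℂ) ^ (α - 1) * Complex.exp (-(t * y)) * h y) -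
        Complex.Gamma α * c‖ ≤ K * Real.Gamma (α.re + 1) * (1 / t) := by
  have hmeas : Measurable fun y : ℝ => (y : ℂ) ^ (α - 1) * Complex.exp (-(t * y)) := by fun_prop
  have hn : ∀ y : ℝ, 0 < y → ‖(y : ℂ) ^ (α - 1) * Complex.exp (-(t * y))‖ =
      y ^ (α.re - 1) * Real.exp (-t * y) := by
    intro y hy
    rw [norm_mul, Complex.norm_cpow_eq_rpow_re_of_pos hy, Complex.norm_exp]
    simp
  have hI : ∀ s : ℝ, 0 < s →
      MeasureTheory.IntegrableOn (fun y : ℝ => y ^ (s - 1) * Real.exp (-t * y)) (Set.Ioi 0) := by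
    intro s hs
    have := integrableOn_rpow_mul_exp_neg_mul_rpow (p := 1) (s := s - 1) (b := t) (by linarith)
      one_pos ht
    simpa using this
  have hint0 : MeasureTheory.IntegrableOn
      (fun y : ℝ => (y : ℂ) ^ (α - 1) * Complex.exp (-(t * y))) (Set.Ioi 0) := by
    refine (hI _ hα).mono' hmeas.aestronglyMeasurable ?_
    filter_upwards [MeasureTheory.ae_restrict_mem measurableSet_Ioi] with y hy
    exact (hn y hy).le
  have hbound : ∀ y ∈ Set.Ioi (0 : ℝ),
      ‖(y : ℂ) ^ (α - 1) * Complex.exp (-(t * y)) * (h y - c)‖ ≤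
        K * (y ^ (α.re + 1 - 1) * Real.exp (-(t * y))) := by
    intro y hy
    have hy' : 0 < y := hy
    rw [norm_mul, hn y hy]
    have e : y ^ (α.re + 1 - 1) = y ^ (α.re - 1) * y := by
      rw [← Real.rpow_add_one hy'.ne']; ring_nf
    rw [e]
    calc _ ≤ y ^ (α.re - 1) * Real.exp (-t * y) * (K * y) := by
          gcongr; exact hK y hy
      _ = _ := by rw [neg_mul]; ring
  have hI2 : MeasureTheory.IntegrableOn
      (fun y : ℝ => K * (y ^ (α.re + 1 - 1) * Real.exp (-(t * y)))) (Set.Ioi 0) := by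
    have := (hI (α.re + 1) (by linarith)).const_mul K
    simpa only [neg_mul, MeasureTheory.IntegrableOn] using this
  have hint1 : MeasureTheory.IntegrableOn
      (fun y : ℝ => (y : ℂ) ^ (α - 1) * Complex.exp (-(t * y)) * (h y - c)) (Set.Ioi 0) := by
    refine hI2.mono' (hmeas.mul (hm.sub_const c)).aestronglyMeasurable ?_
    filter_upwards [MeasureTheory.ae_restrict_mem measurableSet_Ioi] with y hy
    exact hbound y hy
  have hG := Complex.integral_cpow_mul_exp_neg_mul_Ioi hα ht
  have ht0 : (t : ℂ) ≠ 0 := by exact_mod_cast ht.ne'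
  have hta : (t : ℂ) ^ α * (1 / (t : ℂ)) ^ α = 1 := by
    rw [one_div, Complex.inv_cpow _ _ (by rw [Complex.arg_ofReal_of_nonneg ht.le]; exact Real.pi_pos.ne),
      mul_inv_cancel₀ (by simp [Complex.cpow_eq_zero_iff, ht0])]
  -- The constant c integrates exactly to Γ(α) c, leaving only h - c, which gains a factor y and
  -- hence a factor 1/t.
  have hsplit : (t : ℂ) ^ α *
      (∫ y in Set.Ioi (0 : ℝ), (y : ℂ) ^ (α - 1) * Complex.exp (-(t * y)) * h y) -
        Complex.Gamma α * c = (t : ℂ) ^ α *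
      (∫ y in Set.Ioi (0 : ℝ), (y : ℂ) ^ (α - 1) * Complex.exp (-(t * y)) * (h y - c)) := by
    have e : ∀ y : ℝ, (y : ℂ) ^ (α - 1) * Complex.exp (-(t * y)) * h y =
        (y : ℂ) ^ (α - 1) * Complex.exp (-(t * y)) * (h y - c) +
        (y : ℂ) ^ (α - 1) * Complex.exp (-(t * y)) * c := fun y => by ring
    simp_rw [e]
    rw [MeasureTheory.integral_add hint1 (hint0.mul_const c), MeasureTheory.integral_mul_const, hG]
    linear_combination (Complex.Gamma α * c) * hta
  rw [hsplit, norm_mul, Complex.norm_cpow_eq_rpow_re_of_pos ht]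
  have h1 := MeasureTheory.norm_integral_le_of_norm_le hI2
    ((MeasureTheory.ae_restrict_mem measurableSet_Ioi).mono hbound)
  rw [MeasureTheory.integral_const_mul,
    Real.integral_rpow_mul_exp_neg_mul_Ioi (by linarith : 0 < α.re + 1) ht] at h1
  calc _ ≤ t ^ α.re * (K * ((1 / t) ^ (α.re + 1) * Real.Gamma (α.re + 1))) := by gcongr
    _ = _ := by
      rw [Real.rpow_add_one (by positivity), Real.div_rpow zero_le_one ht.le, Real.one_rpow]
      have := (Real.rpow_pos_of_pos ht α.re).ne'
      field_simp

/-! ### Poisson's integral -/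

/-- Converts the (2m)! of the cosine series into the m! of the Bessel series; the 4^m becomes the
2^(2m) in (t/2)^(2m). -/
theorem Complex.Gamma_natCast_add_half (m : ℕ) :
    Complex.Gamma (m + 1 / 2) * (4 ^ m * m.factorial) =
      (2 * m).factorial * (Real.sqrt Real.pi : ℂ) := by
  induction m with
  | zero =>
    have h := Complex.Gamma_one_half_eq
    simp only [Nat.cast_zero, zero_add, pow_zero, Nat.factorial_zero, Nat.cast_one, mul_one,
      mul_zero, one_mul, h, Real.sqrt_eq_rpow, Complex.ofReal_cpow Real.pi_pos.le]
    norm_num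
  | succ m ih =>
    have h0 : (m : ℂ) + 1 / 2 ≠ 0 := by
      intro h
      have := congrArg Complex.re h
      simp at this
      linarith [(Nat.cast_nonneg m : (0 : ℝ) ≤ m)]
    have e : ((m + 1 : ℕ) : ℂ) + 1 / 2 = m + 1 / 2 + 1 := by push_cast; ring
    rw [e, Complex.Gamma_add_one _ h0, show 2 * (m + 1) = 2 * m + 1 + 1 by ring,
      Nat.factorial_succ, Nat.factorial_succ, Nat.factorial_succ]
    push_cast
    linear_combination (4 * (m + 1 / 2 : ℂ) * (m + 1)) * ih

/-- The base vanishes at s = ±1, where continuity of the power needs Re β > 0. This is the source of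
the restriction Re ν > 1/2. -/
theorem continuous_one_sub_sq_cpow {β : ℂ} (hβ : 0 < β.re) :
    ContinuousOn (fun s : ℝ => (1 - (s : ℂ) ^ 2) ^ β) (Set.Icc (-1) 1) := by
  intro s hs
  have h : (1 - (s : ℂ) ^ 2) = ((1 - s ^ 2 : ℝ) : ℂ) := by push_cast; rfl
  have h2 : 0 ≤ 1 - s ^ 2 := by nlinarith [hs.1, hs.2]
  refine ContinuousAt.continuousWithinAt ?_
  have hc : ContinuousAt (fun z : ℂ => z ^ β) (1 - (s : ℂ) ^ 2) := by
    have := Complex.continuousAt_cpow_of_re_pos (p := (1 - (s : ℂ) ^ 2, β)) (by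
      left; rw [h, Complex.ofReal_re]; exact h2) hβ
    exact this.comp (f := fun z : ℂ => (z, β)) (by fun_prop)
  exact hc.comp (f := fun s : ℝ => 1 - (s : ℂ) ^ 2) (by fun_prop)

/-- The substitution u = s² turns this into half the Beta integral B(m + 1/2, α). -/
theorem integral_pow_mul_one_sub_sq_cpow {α : ℂ} (hα : 1 < α.re) (m : ℕ) :
    ∫ s in (0 : ℝ)..1, (s : ℂ) ^ (2 * m) * (1 - (s : ℂ) ^ 2) ^ (α - 1) =
      Complex.Gamma (m + 1 / 2) * Complex.Gamma α / Complex.Gamma (m + 1 / 2 + α) / 2 := by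
  have hm : 0 < ((m : ℂ) + 1 / 2).re := by simp; positivity
  -- The Jacobian 2x absorbs the singularity u^(-1/2) that the Beta integrand has at 0 when m = 0.
  have hpt : ∀ x : ℝ, 0 < x → (2 * x) • (((x ^ 2 : ℝ) : ℂ) ^ ((m : ℂ) + 1 / 2 - 1) *
      (1 - ((x ^ 2 : ℝ) : ℂ)) ^ (α - 1)) =
      2 * ((x : ℂ) ^ (2 * m) * (1 - (x : ℂ) ^ 2) ^ (α - 1)) := by
    intro x hx
    have hx0 : (x : ℂ) ≠ 0 := by exact_mod_cast hx.ne'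
    have e : (x : ℂ) * ((x ^ 2 : ℝ) : ℂ) ^ ((m : ℂ) + 1 / 2 - 1) = (x : ℂ) ^ (2 * m) := by
      rw [pow_two, Complex.ofReal_mul, Complex.mul_cpow_ofReal_nonneg hx.le hx.le,
        ← Complex.cpow_add _ _ hx0]
      nth_rewrite 1 [← Complex.cpow_one (x : ℂ)]
      rw [← Complex.cpow_add _ _ hx0, ← Complex.cpow_natCast]
      congr 1
      push_cast
      ring
    rw [← e, Complex.real_smul]
    push_cast
    ring
  have hcont : ContinuousOn
      (fun x : ℝ => 2 * ((x : ℂ) ^ (2 * m) * (1 - (x : ℂ) ^ 2) ^ (α - 1))) (Set.Icc 0 1) := by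
    have := (continuous_one_sub_sq_cpow (β := α - 1) (by simpa using hα)).mono
      (Set.Icc_subset_Icc_left (by norm_num : (-1 : ℝ) ≤ 0))
    fun_prop
  have hbeta := Complex.betaIntegral_convergent hm (lt_trans one_pos hα)
  have hsub := intervalIntegral.integral_deriv_smul_comp''' (a := 0) (b := 1)
    (f := fun x : ℝ => x ^ 2) (f' := fun x => 2 * x)
    (g := fun u : ℝ => (u : ℂ) ^ ((m : ℂ) + 1 / 2 - 1) * (1 - (u : ℂ)) ^ (α - 1))
    (by fun_prop) (fun x _ => by simpa using (hasDerivAt_pow 2 x).hasDerivWithinAt) (by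
      rintro _ ⟨x, hx, rfl⟩
      simp only [zero_le_one, inf_of_le_left, sup_of_le_right, Set.mem_Ioo] at hx
      refine ContinuousAt.continuousWithinAt ?_
      have h1 : ((x ^ 2 : ℝ) : ℂ) ∈ Complex.slitPlane :=
        Complex.ofReal_mem_slitPlane.2 (by have := hx.1; positivity)
      have h2 : 1 - ((x ^ 2 : ℝ) : ℂ) ∈ Complex.slitPlane := by
        rw [← Complex.ofReal_one, ← Complex.ofReal_sub]
        exact Complex.ofReal_mem_slitPlane.2 (by nlinarith [hx.1, hx.2])
      exact (Complex.continuous_ofReal.continuousAt.cpow continuousAt_const h1).mul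
        ((continuousAt_const.sub Complex.continuous_ofReal.continuousAt).cpow continuousAt_const h2))
    (by
      have : (fun x : ℝ => x ^ 2) '' Set.uIcc 0 1 ⊆ Set.Icc 0 1 := by
        rintro _ ⟨x, hx, rfl⟩
        rw [Set.uIcc_of_le zero_le_one] at hx
        exact ⟨by positivity, by nlinarith [hx.1, hx.2]⟩
      refine MeasureTheory.IntegrableOn.mono_set ?_ this
      rw [integrableOn_Icc_iff_integrableOn_Ioc]
      exact (intervalIntegrable_iff_integrableOn_Ioc_of_le zero_le_one).1 hbeta)
    (by
      rw [Set.uIcc_of_le zero_le_one, integrableOn_Icc_iff_integrableOn_Ioc]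
      have h3 := (hcont.integrableOn_Icc (μ := MeasureTheory.volume)).mono_set Set.Ioc_subset_Icc_self
      refine h3.congr_fun (fun x hx => ?_) measurableSet_Ioc
      exact (hpt x hx.1).symm)
  have hleft : ∫ x in (0 : ℝ)..1, (2 * x) •
      ((fun u : ℝ => (u : ℂ) ^ ((m : ℂ) + 1 / 2 - 1) * (1 - (u : ℂ)) ^ (α - 1)) ∘
        fun x : ℝ => x ^ 2) x =
      2 * ∫ s in (0 : ℝ)..1, (s : ℂ) ^ (2 * m) * (1 - (s : ℂ) ^ 2) ^ (α - 1) := by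
    rw [← intervalIntegral.integral_const_mul]
    refine intervalIntegral.integral_congr_ae (Eventually.of_forall fun x hx => ?_)
    rw [Set.uIoc_of_le zero_le_one] at hx
    exact hpt x hx.1
  rw [hleft] at hsub
  have hb := Complex.betaIntegral_eq_Gamma_mul_div _ _ hm (lt_trans one_pos hα)
  rw [← hb, Complex.betaIntegral, eq_div_iff two_ne_zero, mul_comm, hsub]
  norm_num

/-- Termwise integration of the cosine series, dominated by |t|^(2m)/(2m)! times the fixed weight.
-/
theorem hasSum_integral_cos_mul_one_sub_sq_cpow {α : ℂ} (hα : 1 < α.re) (t : ℝ) :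
    HasSum (fun m : ℕ => ∫ s in (0 : ℝ)..1,
        (-1) ^ m * ((t : ℂ) * s) ^ (2 * m) / (2 * m).factorial * (1 - (s : ℂ) ^ 2) ^ (α - 1))
      (∫ s in (0 : ℝ)..1, Complex.cos (t * s) * (1 - (s : ℂ) ^ 2) ^ (α - 1)) := by
  have hc := (continuous_one_sub_sq_cpow (β := α - 1) (by simpa using hα)).mono
      (Set.Icc_subset_Icc_left (by norm_num : (-1 : ℝ) ≤ 0))
  have hI : Set.uIoc (0 : ℝ) 1 ⊆ Set.Icc 0 1 := by
    rw [Set.uIoc_of_le zero_le_one]; exact Set.Ioc_subset_Icc_self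
  have hsum : Summable fun m : ℕ => |t| ^ (2 * m) / (2 * m).factorial :=
    (Real.summable_pow_div_factorial |t|).comp_injective
      (i := fun m : ℕ => 2 * m) (fun a b h => by simpa using h)
  refine intervalIntegral.hasSum_integral_of_dominated_convergence
    (fun m s => |t| ^ (2 * m) / (2 * m).factorial * ‖(1 - (s : ℂ) ^ 2) ^ (α - 1)‖)
    (fun m => ?_) (fun m => Eventually.of_forall fun s hs => ?_)
    (Eventually.of_forall fun s _ => hsum.mul_right _) ?_
    (Eventually.of_forall fun s _ => (Complex.hasSum_cos _).mul_right _)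
  · refine ContinuousOn.aestronglyMeasurable ?_ measurableSet_uIoc
    have := hc.mono hI
    fun_prop
  · have h := hI hs
    rw [norm_mul, norm_div, norm_mul, norm_pow, norm_pow, norm_mul]
    simp only [norm_neg, norm_one, one_pow, one_mul, Complex.norm_real, Real.norm_eq_abs,
      Complex.norm_natCast]
    gcongr
    rw [abs_of_nonneg h.1]
    exact mul_le_of_le_one_right (abs_nonneg t) h.2
  · simp_rw [tsum_mul_right]
    refine ContinuousOn.intervalIntegrable ?_
    rw [Set.uIcc_of_le zero_le_one]
    fun_prop

/-- Poisson's integral for the Bessel function. -/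
theorem besselJ_mul_eq_integral {ν : ℂ} (hν : 1 / 2 < ν.re) (t : ℝ) :
    besselJ ν t * ((Real.sqrt Real.pi : ℂ) * Complex.Gamma (ν + 1 / 2)) =
      ((t : ℂ) / 2) ^ ν * ∫ s in (-1 : ℝ)..1,
        Complex.exp (Complex.I * t * s) * (1 - (s : ℂ) ^ 2) ^ (ν + 1 / 2 - 1) := by
  have hα : 1 < (ν + 1 / 2).re := by simp; linarith
  set α := ν + 1 / 2 with hαdef
  have hc := continuous_one_sub_sq_cpow (β := α - 1) (by simpa using hα)
  -- The weight is even, so only the cosine part of the exponential survives.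
  have hsplit : (∫ s in (-1 : ℝ)..1, Complex.exp (Complex.I * t * s) *
      (1 - (s : ℂ) ^ 2) ^ (α - 1)) =
      2 * ∫ s in (0 : ℝ)..1, Complex.cos (t * s) * (1 - (s : ℂ) ^ 2) ^ (α - 1) := by
    have hi : ∀ a b : ℝ, -1 ≤ a → a ≤ b → b ≤ 1 → IntervalIntegrable (fun s : ℝ =>
        Complex.exp (Complex.I * t * s) * (1 - (s : ℂ) ^ 2) ^ (α - 1))
        MeasureTheory.volume a b := by
      intro a b h1 h2 h3
      refine ContinuousOn.intervalIntegrable ?_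
      rw [Set.uIcc_of_le h2]
      have := hc.mono (Set.Icc_subset_Icc h1 h3)
      fun_prop
    have hi' : IntervalIntegrable (fun s : ℝ =>
        Complex.exp (Complex.I * t * (-s : ℝ)) * (1 - ((-s : ℝ) : ℂ) ^ 2) ^ (α - 1))
        MeasureTheory.volume 0 1 := by
      refine ContinuousOn.intervalIntegrable ?_
      rw [Set.uIcc_of_le zero_le_one]
      have := hc.mono (Set.Icc_subset_Icc_left (by norm_num : (-1 : ℝ) ≤ 0))
      simp only [Complex.ofReal_neg, neg_sq]
      fun_prop
    have hneg := intervalIntegral.integral_comp_neg (a := 0) (b := 1) (fun s : ℝ =>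
        Complex.exp (Complex.I * t * s) * (1 - (s : ℂ) ^ 2) ^ (α - 1))
    rw [neg_zero] at hneg
    rw [← intervalIntegral.integral_add_adjacent_intervals
      (hi (-1) 0 le_rfl (by norm_num) (by norm_num)) (hi 0 1 (by norm_num) (by norm_num) le_rfl),
      ← hneg, ← intervalIntegral.integral_add hi' (hi 0 1 (by norm_num) (by norm_num) le_rfl),
      ← intervalIntegral.integral_const_mul]
    refine intervalIntegral.integral_congr fun s _ => ?_
    simp only [Complex.ofReal_neg, neg_sq, Complex.cos]
    ring_nf
  have hterm : ∀ m : ℕ, (∫ s in (0 : ℝ)..1,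
      (-1) ^ m * ((t : ℂ) * s) ^ (2 * m) / (2 * m).factorial * (1 - (s : ℂ) ^ 2) ^ (α - 1)) * 2 =
      (-1) ^ m * (((t : ℂ) / 2) ^ (2 * m) / (Complex.Gamma (ν + m + 1) * (m.factorial : ℂ))) *
        ((Real.sqrt Real.pi : ℂ) * Complex.Gamma α) := by
    intro m
    have e1 : (∫ s in (0 : ℝ)..1, (-1) ^ m * ((t : ℂ) * s) ^ (2 * m) / (2 * m).factorial *
        (1 - (s : ℂ) ^ 2) ^ (α - 1)) = (-1) ^ m * (t : ℂ) ^ (2 * m) / (2 * m).factorial *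
        ∫ s in (0 : ℝ)..1, (s : ℂ) ^ (2 * m) * (1 - (s : ℂ) ^ 2) ^ (α - 1) := by
      rw [← intervalIntegral.integral_const_mul]
      refine intervalIntegral.integral_congr fun s _ => ?_
      simp only [mul_pow]
      ring
    have e2 : (m : ℂ) + 1 / 2 + α = ν + m + 1 := by rw [hαdef]; ring
    have h1 : ((2 * m).factorial : ℂ) ≠ 0 := by exact_mod_cast (2 * m).factorial_ne_zero
    have h2 : (m.factorial : ℂ) ≠ 0 := by exact_mod_cast m.factorial_ne_zero
    have h3 : Complex.Gamma (ν + m + 1) ≠ 0 := Complex.Gamma_ne_zero_of_re_pos (by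
      simp; linarith [(Nat.cast_nonneg m : (0 : ℝ) ≤ m)])
    have hG := Complex.Gamma_natCast_add_half m
    have h4 : (2 : ℂ) ^ (2 * m) = 4 ^ m := by rw [pow_mul]; norm_num
    rw [e1, integral_pow_mul_one_sub_sq_cpow hα, e2, div_pow, h4]
    generalize Complex.Gamma ((m : ℂ) + 1 / 2) = g at hG ⊢
    field_simp
    linear_combination (t : ℂ) ^ (2 * m) * Complex.Gamma α * hG
  have hs := ((hasSum_integral_cos_mul_one_sub_sq_cpow hα t).mul_right 2).tsum_eq
  simp_rw [hterm] at hs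
  rw [tsum_mul_right] at hs
  rw [hsplit, mul_comm 2, ← hs, besselJ]
  ring

/-! ### Change of contour -/

/-- Cauchy's theorem for `exp (i t z) (1 - z ^ 2) ^ β` on the rectangle `[-1, 1] × [0, 1]`. -/
theorem integral_exp_mul_one_sub_sq_cpow_eq {β : ℂ} (hβ : 0 < β.re) (t : ℝ) :
    ∫ s in (-1 : ℝ)..1, Complex.exp (Complex.I * t * s) * (1 - (s : ℂ) ^ 2) ^ β =
      (∫ s in (-1 : ℝ)..1, Complex.exp (Complex.I * t * (s + Complex.I)) *
        (1 - (s + Complex.I) ^ 2) ^ β) -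
      Complex.I * (∫ y in (0 : ℝ)..1, Complex.exp (Complex.I * t * (1 + y * Complex.I)) *
        (1 - (1 + y * Complex.I) ^ 2) ^ β) +
      Complex.I * (∫ y in (0 : ℝ)..1, Complex.exp (Complex.I * t * (-1 + y * Complex.I)) *
        (1 - (-1 + y * Complex.I) ^ 2) ^ β) := by
  -- On the closed rectangle this real part is nonnegative, and it vanishes only at z = ±1, so the
  -- branch cut is met nowhere else.
  have hre : ∀ z : ℂ, (1 - z ^ 2).re = 1 - z.re ^ 2 + z.im ^ 2 := by
    intro z; simp [pow_two]; ring
  have h := Complex.integral_boundary_rect_eq_zero_of_continuousOn_of_differentiableOn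
    (fun z : ℂ => Complex.exp (Complex.I * t * z) * (1 - z ^ 2) ^ β) (-1) (1 + Complex.I)
    (by
      intro z hz
      refine ContinuousAt.continuousWithinAt ?_
      simp only [Complex.neg_re, Complex.one_re, Complex.add_re, Complex.I_re, add_zero,
        Complex.neg_im, Complex.one_im, neg_zero, Complex.add_im, Complex.I_im, zero_add,
        Complex.mem_reProdIm] at hz
      obtain ⟨h1, h2⟩ := hz
      rw [Set.uIcc_of_le (by norm_num)] at h1
      have hc : ContinuousAt (fun w : ℂ => w ^ β) (1 - z ^ 2) := by
        have := Complex.continuousAt_cpow_of_re_pos (p := (1 - z ^ 2, β)) (by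
          left; rw [hre]; nlinarith [h1.1, h1.2, sq_nonneg z.im]) hβ
        exact this.comp (f := fun w : ℂ => (w, β)) (by fun_prop)
      have hc' : ContinuousAt (fun z : ℂ => (1 - z ^ 2) ^ β) z :=
        hc.comp (f := fun z : ℂ => 1 - z ^ 2) (by fun_prop)
      fun_prop)
    (by
      intro z hz
      refine DifferentiableAt.differentiableWithinAt ?_
      simp only [Complex.neg_re, Complex.one_re, Complex.add_re, Complex.I_re, add_zero,
        Complex.neg_im, Complex.one_im, neg_zero, Complex.add_im, Complex.I_im, zero_add,
        Complex.mem_reProdIm] at hz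
      obtain ⟨h1, h2⟩ := hz
      rw [min_eq_left (by norm_num), max_eq_right (by norm_num)] at h1
      have hs : 1 - z ^ 2 ∈ Complex.slitPlane := by
        left; rw [hre]; nlinarith [h1.1, h1.2, sq_nonneg z.im]
      have : DifferentiableAt ℂ (fun z : ℂ => (1 - z ^ 2) ^ β) z :=
        DifferentiableAt.cpow_const (by fun_prop) hs
      fun_prop)
  simp only [Complex.neg_re, Complex.one_re, Complex.add_re, Complex.I_re, add_zero,
    Complex.neg_im, Complex.one_im, neg_zero, Complex.add_im, Complex.I_im, zero_add,
    Complex.ofReal_zero, zero_mul, Complex.ofReal_one, one_mul, Complex.ofReal_neg,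
    smul_eq_mul] at h
  linear_combination h

/-! ### Asymptotics of the three sides -/

theorem ofReal_mul_cpow {r : ℝ} (hr : 0 < r) {x : ℂ} (hx : x ≠ 0) (a : ℂ) :
    ((r : ℂ) * x) ^ a = (r : ℂ) ^ a * x ^ a := by
  have hr' : (r : ℂ) ≠ 0 := by exact_mod_cast hr.ne'
  rw [Complex.cpow_def_of_ne_zero (mul_ne_zero hr' hx), Complex.cpow_def_of_ne_zero hr',
    Complex.cpow_def_of_ne_zero hx, Complex.log_ofReal_mul hr hx, add_mul, Complex.exp_add,
    Complex.ofReal_log hr.le]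

/-- Since b is not real, y + b avoids the cut and the mean value inequality applies on [0, 1]. For y
> 1 the truncated function is 0 and ‖b^β‖ ≤ ‖b^β‖ y, so an integral over [0, 1] fits Watson's lemma
on the half-line with no tail estimate. -/
theorem exists_norm_add_cpow_sub_le {b : ℂ} (hb : b.im ≠ 0) (β : ℂ) :
    ∃ K, ∀ y : ℝ, 0 < y →
      ‖(if y ≤ 1 then ((y : ℂ) + b) ^ β else 0) - b ^ β‖ ≤ K * y := by
  have hs : ∀ y : ℝ, (y : ℂ) + b ∈ Complex.slitPlane := fun y => by right; simpa using hb
  have hd : ∀ y : ℝ, HasDerivAt (fun y : ℝ => ((y : ℂ) + b) ^ β)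
      (β * ((y : ℂ) + b) ^ (β - 1)) y := by
    intro y
    have h1 : HasDerivAt (fun z : ℂ => (z + b) ^ β) (β * ((y : ℂ) + b) ^ (β - 1) * 1) (y : ℂ) :=
      ((hasDerivAt_id (y : ℂ)).add_const b).cpow_const (hs y)
    simpa using h1.comp_ofReal
  have hc : Continuous fun y : ℝ => β * ((y : ℂ) + b) ^ (β - 1) :=
    continuous_const.mul ((Complex.continuous_ofReal.add_const b).cpow continuous_const hs)
  obtain ⟨C, hC⟩ := isCompact_Icc.exists_bound_of_continuousOn (s := Set.Icc (0 : ℝ) 1)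
    hc.continuousOn
  refine ⟨max C ‖b ^ β‖, fun y hy => ?_⟩
  split_ifs with h
  · have := (convex_Icc (0 : ℝ) 1).norm_image_sub_le_of_norm_hasDerivWithin_le
      (fun x _ => (hd x).hasDerivWithinAt) hC (Set.left_mem_Icc.2 zero_le_one) ⟨hy.le, h⟩
    simp only [Complex.ofReal_zero, zero_add, sub_zero, Real.norm_eq_abs, abs_of_pos hy] at this
    exact this.trans (by gcongr; exact le_max_left _ _)
  · rw [zero_sub, norm_neg]
    exact (le_max_right C ‖b ^ β‖).trans
      (le_mul_of_one_le_right ((norm_nonneg _).trans (le_max_right _ _)) (not_le.1 h).le)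

/-- The contribution of one vertical side: for z = ±1 + iy, 1 - z² = y(y + b) with b = ∓2i. -/
theorem isBigO_cpow_mul_integral_exp_neg {α : ℂ} (hα : 1 < α.re) {b : ℂ} (hb : b.im ≠ 0) :
    (fun t : ℝ => (t : ℂ) ^ α * (∫ y in (0 : ℝ)..1,
        Complex.exp (-(t * y)) * ((y : ℂ) * (y + b)) ^ (α - 1)) -
      Complex.Gamma α * b ^ (α - 1)) =O[atTop] fun t : ℝ => 1 / t := by
  obtain ⟨K, hK⟩ := exists_norm_add_cpow_sub_le hb (α - 1)
  refine IsBigO.of_bound (K * Real.Gamma (α.re + 1)) ?_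
  filter_upwards [eventually_gt_atTop 0] with t ht
  have hmeas : Measurable fun y : ℝ => if y ≤ 1 then ((y : ℂ) + b) ^ (α - 1) else 0 :=
    Measurable.ite measurableSet_Iic (by fun_prop) measurable_const
  have h := norm_cpow_mul_integral_exp_neg_sub_le (by linarith) hmeas hK ht
  rw [Real.norm_of_nonneg (by positivity : 0 ≤ 1 / t)]
  convert h using 5
  rw [intervalIntegral.integral_of_le zero_le_one, ← Set.Ioi_inter_Iic,
    ← MeasureTheory.setIntegral_indicator measurableSet_Iic]
  refine MeasureTheory.setIntegral_congr_fun measurableSet_Ioi fun y hy => ?_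
  by_cases h1 : y ≤ 1
  · have hne : (y : ℂ) + b ≠ 0 := fun h0 => hb (by simpa using congrArg Complex.im h0)
    simp only [Set.indicator, Set.mem_Iic, h1, if_true]
    rw [ofReal_mul_cpow hy hne]
    ring
  · simp [Set.indicator, h1]

/-- On the top side |exp(itz)| = e^(-t), which beats every power of t. -/
theorem isBigO_cpow_mul_integral_top {α : ℂ} (β : ℂ) :
    (fun t : ℝ => (t : ℂ) ^ α * ∫ s in (-1 : ℝ)..1,
        Complex.exp (Complex.I * t * (s + Complex.I)) * (1 - (s + Complex.I) ^ 2) ^ β)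
      =O[atTop] fun t : ℝ => 1 / t := by
  have hc : ContinuousOn (fun s : ℝ => (1 - ((s : ℂ) + Complex.I) ^ 2) ^ β) (Set.Icc (-1) 1) := by
    intro s hs
    refine ContinuousAt.continuousWithinAt (ContinuousAt.cpow (by fun_prop) continuousAt_const ?_)
    -- The real part is 2 - s² ≥ 1.
    left
    simp [pow_two]
    nlinarith [hs.1, hs.2]
  obtain ⟨K, hK⟩ := isCompact_Icc.exists_bound_of_continuousOn hc
  have h1 : (fun t : ℝ => (t : ℂ) ^ α * ∫ s in (-1 : ℝ)..1,
        Complex.exp (Complex.I * t * (s + Complex.I)) * (1 - (s + Complex.I) ^ 2) ^ β)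
      =O[atTop] fun t : ℝ => t ^ α.re * Real.exp (-1 * t) := by
    refine IsBigO.of_bound (K * 2) ?_
    filter_upwards [eventually_gt_atTop 0] with t ht
    have := intervalIntegral.norm_integral_le_of_norm_le_const (a := -1) (b := 1)
      (C := Real.exp (-1 * t) * K) (f := fun s : ℝ =>
        Complex.exp (Complex.I * t * (s + Complex.I)) * (1 - (s + Complex.I) ^ 2) ^ β) (by
      intro s hs
      rw [Set.uIoc_of_le (by norm_num)] at hs
      have e : ‖Complex.exp (Complex.I * t * (s + Complex.I))‖ = Real.exp (-1 * t) := by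
        rw [Complex.norm_exp]; simp
      rw [norm_mul, e]
      gcongr
      exact hK s (Set.Ioc_subset_Icc_self hs))
    rw [norm_mul, Complex.norm_cpow_eq_rpow_re_of_pos ht,
      Real.norm_of_nonneg (by positivity : 0 ≤ t ^ α.re * Real.exp (-1 * t))]
    norm_num at this
    calc _ ≤ t ^ α.re * (Real.exp (-t) * K * 2) := by gcongr
      _ = _ := by rw [neg_one_mul]; ring
  refine h1.trans (((isBigO_refl (fun t : ℝ => t ^ α.re) atTop).mul
    (isLittleO_exp_neg_mul_rpow_atTop one_pos (-1 - α.re)).isBigO).trans ?_)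
  refine EventuallyEq.isBigO ?_
  filter_upwards [eventually_gt_atTop 0] with t ht
  rw [← Real.rpow_add ht, show α.re + (-1 - α.re) = -1 by ring, Real.rpow_neg_one, one_div]

theorem isBigO_exp_mul_I_mul {f : ℝ → ℂ} {g : ℝ → ℝ} (hf : f =O[atTop] g) (r : ℝ) :
    (fun t : ℝ => Complex.exp (Complex.I * t * r) * f t) =O[atTop] g := by
  refine IsBigO.trans (IsBigO.of_bound 1 (Eventually.of_forall fun t => ?_)) hf
  rw [norm_mul, Complex.norm_exp]
  simp

/-! ### Hankel's asymptotics -/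

/-- The leading oscillation of `√t J_ν(t)`, as the endpoints of Poisson's integral give it. -/
theorem endpoint_contributions_eq (ν : ℂ) (t : ℝ) :
    (1 / 2 : ℂ) ^ ν * (-(Complex.I * (Complex.exp (Complex.I * t * (1 : ℝ)) *
        (-2 * Complex.I) ^ (ν + 1 / 2 - 1))) +
      Complex.I * (Complex.exp (Complex.I * t * (-1 : ℝ)) *
        (2 * Complex.I) ^ (ν + 1 / 2 - 1))) =
    (Real.sqrt 2 : ℂ) * Complex.cos (t - Real.pi * ν / 2 - Real.pi / 4) := by
  have h1 : Complex.log (1 / 2) = -((Real.log 2 : ℝ) : ℂ) := by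
    rw [← Complex.ofReal_neg, ← Real.log_inv, Complex.ofReal_log (by norm_num)]; norm_num
  have h2 : Complex.log (2 * Complex.I) = (Real.log 2 : ℝ) + Real.pi / 2 * Complex.I := by
    have := Complex.log_ofReal_mul two_pos Complex.I_ne_zero
    rw [Complex.log_I] at this
    exact_mod_cast this
  have h3 : Complex.log (-2 * Complex.I) = (Real.log 2 : ℝ) + -(Real.pi / 2) * Complex.I := by
    have := Complex.log_ofReal_mul two_pos (neg_ne_zero.2 Complex.I_ne_zero)
    rw [Complex.log_neg_I] at this
    rw [show -2 * Complex.I = ((2 : ℝ) : ℂ) * -Complex.I by push_cast; ring, this]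
  -- All factors, ±i and √2 included, become exponentials, so that only exponents remain to be
  -- compared.
  have hI : ∀ x, Complex.I * Complex.exp x = Complex.exp (Real.pi / 2 * Complex.I + x) := by
    intro x; rw [Complex.exp_add, Complex.exp_pi_div_two_mul_I]
  have hI' : ∀ x, -(Complex.I * Complex.exp x) =
      Complex.exp (-(Real.pi / 2) * Complex.I + x) := by
    intro x
    rw [Complex.exp_add, neg_mul, Complex.exp_neg, Complex.exp_pi_div_two_mul_I, Complex.inv_I,
      neg_mul]
  have hs : (Real.sqrt 2 : ℂ) = 2 * Complex.exp (-((Real.log 2 : ℝ) : ℂ) / 2) := by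
    have h : Real.sqrt 2 = 2 * Real.exp (-Real.log 2 / 2) := by
      rw [Real.exp_half, Real.exp_neg, Real.exp_log two_pos, Real.sqrt_inv]
      have := Real.mul_self_sqrt zero_le_two
      field_simp
      linarith
    rw [h]; push_cast; rfl
  rw [Complex.cpow_def_of_ne_zero (by norm_num), Complex.cpow_def_of_ne_zero (by simp),
    Complex.cpow_def_of_ne_zero (by simp), h1, h2, h3, hs, Complex.cos]
  simp only [← Complex.exp_add]
  rw [hI', hI, mul_add,
    show ∀ a b c : ℂ, 2 * a * ((b + c) / 2) = a * b + a * c from fun _ _ _ => by ring]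
  simp only [← Complex.exp_add]
  congr 2 <;> · push_cast; ring

theorem isBigO_besselJ_sub_cos_of_half_lt_re {ν : ℂ} (hν : 1 / 2 < ν.re) :
    (fun t : ℝ => (Real.sqrt t : ℂ) * besselJ ν t - (Real.sqrt 2 : ℂ) / (Real.sqrt Real.pi : ℂ) *
        Complex.cos (t - Real.pi * ν / 2 - Real.pi / 4)) =O[atTop] fun t : ℝ => 1 / t := by
  have hα : 1 < (ν + 1 / 2).re := by simp; linarith
  set α := ν + 1 / 2 with hαdef
  have hΓ : Complex.Gamma α ≠ 0 := Complex.Gamma_ne_zero_of_re_pos (by linarith)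
  have hπ : (Real.sqrt Real.pi : ℂ) ≠ 0 := by
    exact_mod_cast (Real.sqrt_pos.2 Real.pi_pos).ne'
  have hT := isBigO_cpow_mul_integral_top (α := α) (α - 1)
  have hA := isBigO_exp_mul_I_mul
    (isBigO_cpow_mul_integral_exp_neg hα (b := -2 * Complex.I) (by simp)) 1
  have hB := isBigO_exp_mul_I_mul
    (isBigO_cpow_mul_integral_exp_neg hα (b := 2 * Complex.I) (by simp)) (-1)
  refine (((hT.sub (hA.const_mul_left Complex.I)).add (hB.const_mul_left Complex.I)).const_mul_left
    ((1 / 2 : ℂ) ^ ν / ((Real.sqrt Real.pi : ℂ) * Complex.Gamma α))).congr' ?_ EventuallyEq.rfl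
  filter_upwards [eventually_gt_atTop 0] with t ht
  have hP := besselJ_mul_eq_integral hν t
  rw [← hαdef, integral_exp_mul_one_sub_sq_cpow_eq (by simpa using hα)] at hP
  have hR : (∫ y in (0 : ℝ)..1, Complex.exp (Complex.I * t * (1 + y * Complex.I)) *
        (1 - (1 + y * Complex.I) ^ 2) ^ (α - 1)) = Complex.exp (Complex.I * t * (1 : ℝ)) *
      ∫ y in (0 : ℝ)..1, Complex.exp (-(t * y)) *
        ((y : ℂ) * (y + -2 * Complex.I)) ^ (α - 1) := by
    rw [← intervalIntegral.integral_const_mul]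
    refine intervalIntegral.integral_congr fun y _ => ?_
    simp only [← mul_assoc, ← Complex.exp_add]
    congr 2
    · push_cast; linear_combination (t * y : ℂ) * Complex.I_sq
    · linear_combination (-y ^ 2 : ℂ) * Complex.I_sq
  have hL : (∫ y in (0 : ℝ)..1, Complex.exp (Complex.I * t * (-1 + y * Complex.I)) *
        (1 - (-1 + y * Complex.I) ^ 2) ^ (α - 1)) = Complex.exp (Complex.I * t * (-1 : ℝ)) *
      ∫ y in (0 : ℝ)..1, Complex.exp (-(t * y)) *
        ((y : ℂ) * (y + 2 * Complex.I)) ^ (α - 1) := by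
    rw [← intervalIntegral.integral_const_mul]
    refine intervalIntegral.integral_congr fun y _ => ?_
    simp only [← mul_assoc, ← Complex.exp_add]
    congr 2
    · push_cast; linear_combination (t * y : ℂ) * Complex.I_sq
    · linear_combination (-y ^ 2 : ℂ) * Complex.I_sq
  have ht0 : (t : ℂ) ≠ 0 := by exact_mod_cast ht.ne'
  have hpow : (Real.sqrt t : ℂ) * ((t : ℂ) / 2) ^ ν = (1 / 2 : ℂ) ^ ν * (t : ℂ) ^ α := by
    have e1 : ((t : ℂ) / 2) ^ ν = (t : ℂ) ^ ν * (1 / 2 : ℂ) ^ ν := by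
      rw [← ofReal_mul_cpow ht (by norm_num)]; congr 1; ring
    have e2 : (Real.sqrt t : ℂ) = (t : ℂ) ^ (1 / 2 : ℂ) := by
      rw [Real.sqrt_eq_rpow, Complex.ofReal_cpow ht.le]; push_cast; rfl
    rw [e1, e2, hαdef, Complex.cpow_add _ _ ht0]
    ring
  have hM := endpoint_contributions_eq ν t
  rw [← hαdef] at hM
  rw [hR, hL] at hP
  have hJ := eq_div_of_mul_eq (mul_ne_zero hπ hΓ) hP
  rw [hJ, div_mul_eq_mul_div, div_mul_eq_mul_div (Real.sqrt 2 : ℂ), ← hM, mul_div_assoc',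
    ← mul_assoc (Real.sqrt t : ℂ), hpow]
  generalize Complex.exp (Complex.I * t * (1 : ℝ)) = E₁
  generalize Complex.exp (Complex.I * t * (-1 : ℝ)) = E₂
  generalize (-2 * Complex.I) ^ (α - 1) = p₁
  generalize (2 * Complex.I) ^ (α - 1) = p₂
  generalize (1 / 2 : ℂ) ^ ν = q
  field_simp
  ring

/-- Along the shifted real line the imaginary part of the argument is constant, so the complex
cosine stays bounded. -/
theorem isBigO_cos_ofReal_sub_one (c : ℂ) :
    (fun t : ℝ => Complex.cos (t - c)) =O[atTop] fun _ : ℝ => (1 : ℝ) := by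
  refine IsBigO.of_bound (‖Complex.cos c‖ + ‖Complex.sin c‖) (Eventually.of_forall fun t => ?_)
  rw [Complex.cos_sub, norm_one, mul_one]
  refine (norm_add_le _ _).trans ?_
  rw [norm_mul, norm_mul, ← Complex.ofReal_cos, ← Complex.ofReal_sin, Complex.norm_real,
    Complex.norm_real]
  exact add_le_add (mul_le_of_le_one_left (norm_nonneg _) (Real.abs_cos_le_one t))
    (mul_le_of_le_one_left (norm_nonneg _) (Real.abs_sin_le_one t))

theorem isBigO_one_div_one : (fun t : ℝ => 1 / t) =O[atTop] fun _ : ℝ => (1 : ℝ) := by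
  have : Tendsto (fun t : ℝ => 1 / t) atTop (𝓝 0) := by simpa using tendsto_inv_atTop_zero
  exact this.isBigO_one ℝ

/-- Hankel's leading asymptotics of the Bessel function, for every complex order. -/
theorem isBigO_besselJ_sub_cos (ν : ℂ) :
    (fun t : ℝ => (Real.sqrt t : ℂ) * besselJ ν t - (Real.sqrt 2 : ℂ) / (Real.sqrt Real.pi : ℂ) *
        Complex.cos (t - Real.pi * ν / 2 - Real.pi / 4)) =O[atTop] fun t : ℝ => 1 / t := by
  -- Here n bounds the number of unit shifts that carry Re ν past 1/2; if n = k + 1, then k serves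
  -- for both ν + 1 and ν + 2.
  obtain ⟨n, hn⟩ := exists_nat_gt (1 / 2 - ν.re)
  have hn' : 1 / 2 < ν.re + n := by linarith
  clear hn
  induction n using Nat.strong_induction_on generalizing ν with
  | _ n ih =>
    by_cases hν : 1 / 2 < ν.re
    · exact isBigO_besselJ_sub_cos_of_half_lt_re hν
    obtain ⟨k, rfl⟩ : ∃ k, n = k + 1 :=
      Nat.exists_eq_add_one.2 (Nat.pos_of_ne_zero fun h => hν (by simpa [h] using hn'))
    push_cast at hn'
    have h1 := ih k (by omega) (ν + 1) (by simp; linarith)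
    have h2 := ih k (by omega) (ν + 2) (by simp; linarith)
    have hb : (fun t : ℝ => (Real.sqrt t : ℂ) * besselJ (ν + 1) t) =O[atTop]
        fun _ : ℝ => (1 : ℝ) := by
      have hc := (isBigO_cos_ofReal_sub_one (Real.pi * (ν + 1) / 2 + Real.pi / 4)).const_mul_left
        ((Real.sqrt 2 : ℂ) / (Real.sqrt Real.pi : ℂ))
      refine ((h1.trans isBigO_one_div_one).add hc).congr_left fun t => ?_
      rw [← sub_sub, sub_add_cancel]
    have hinv : (fun t : ℝ => 2 * (ν + 1) / (t : ℂ)) =O[atTop] fun t : ℝ => 1 / t := by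
      refine IsBigO.of_bound ‖2 * (ν + 1)‖ (Eventually.of_forall fun t => ?_)
      simp [div_eq_mul_inv]
    have hprod := (hinv.mul hb).congr_right fun t => mul_one (1 / t)
    refine (hprod.sub h2).congr' ?_ EventuallyEq.rfl
    filter_upwards [eventually_gt_atTop 0] with t ht
    have hrec := besselJ_add_besselJ_add_two ν (z := (t : ℂ)) (by exact_mod_cast ht.ne')
    have hcos : Complex.cos (t - Real.pi * (ν + 2) / 2 - Real.pi / 4) =
        -Complex.cos (t - Real.pi * ν / 2 - Real.pi / 4) := by
      rw [← Complex.cos_sub_pi]; congr 1; ring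
    rw [hcos]
    linear_combination -(Real.sqrt t : ℂ) * hrec

/-! ### Lommel's relation -/

theorem isBigO_lommel (ν : ℂ) :
    (fun t : ℝ => (Real.pi : ℂ) * (t : ℂ) / 2 *
        (besselJ ν (t : ℂ) ^ 2 + besselJ (ν + 1) (t : ℂ) ^ 2) - 1) =O[atTop]
      (fun t : ℝ => 1 / t) := by
  -- Uses f² - g² = (f - g)((f - g) + 2g), whose second factor is bounded.
  have hsq : ∀ {f g : ℝ → ℂ}, (fun t => f t - g t) =O[atTop] (fun t : ℝ => 1 / t) →
      g =O[atTop] (fun _ : ℝ => (1 : ℝ)) →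
      (fun t => f t ^ 2 - g t ^ 2) =O[atTop] (fun t : ℝ => 1 / t) := by
    intro f g h hg
    refine (h.mul ((h.trans isBigO_one_div_one).add (hg.const_mul_left 2))).congr
      (fun t => ?_) (fun t => mul_one _)
    ring
  have hg : ∀ μ : ℂ, (fun t : ℝ => (Real.sqrt 2 : ℂ) / (Real.sqrt Real.pi : ℂ) *
      Complex.cos (t - Real.pi * μ / 2 - Real.pi / 4)) =O[atTop] (fun _ : ℝ => (1 : ℝ)) := by
    intro μ
    simp_rw [sub_sub]
    exact (isBigO_cos_ofReal_sub_one _).const_mul_left _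
  refine (((hsq (isBigO_besselJ_sub_cos ν) (hg ν)).add
    (hsq (isBigO_besselJ_sub_cos (ν + 1)) (hg (ν + 1)))).const_mul_left
      ((Real.pi : ℂ) / 2)).congr' ?_ EventuallyEq.rfl
  filter_upwards [eventually_gt_atTop 0] with t ht
  have h1 : (Real.sqrt t : ℂ) ^ 2 = t := by exact_mod_cast Real.sq_sqrt ht.le
  have h2 : (Real.sqrt 2 : ℂ) ^ 2 = 2 := by exact_mod_cast Real.sq_sqrt zero_le_two
  have h3 : (Real.sqrt Real.pi : ℂ) ^ 2 = Real.pi := by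
    exact_mod_cast Real.sq_sqrt Real.pi_pos.le
  have hπ : (Real.pi : ℂ) ≠ 0 := by exact_mod_cast Real.pi_ne_zero
  have hcos : Complex.cos (t - Real.pi * (ν + 1) / 2 - Real.pi / 4) =
      Complex.sin (t - Real.pi * ν / 2 - Real.pi / 4) := by
    rw [← Complex.cos_sub_pi_div_two]; congr 1; ring
  have hone := Complex.cos_sq_add_sin_sq (t - Real.pi * ν / 2 - Real.pi / 4)
  rw [hcos]
  simp only [mul_pow, div_pow, h1, h2, h3]
  generalize Complex.cos (t - Real.pi * ν / 2 - Real.pi / 4) = x at hone ⊢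
  generalize Complex.sin (t - Real.pi * ν / 2 - Real.pi / 4) = y at hone ⊢
  field_simp
  linear_combination (-2 : ℂ) * hone

theorem theorem1 (ν : ℂ) :
    (fun t : ℝ => (Real.pi : ℂ) * (t : ℂ) / 2 *
        (besselJ ν (t : ℂ) ^ 2 + besselJ (ν + 1) (t : ℂ) ^ 2) - 1) =O[atTop]
      (fun t : ℝ => 1 / t) ∧
    Tendsto (fun t : ℝ => (besselJ ν (t : ℂ) ^ 2 + besselJ (ν + 1) (t : ℂ) ^ 2) /
        (2 / ((Real.pi : ℂ) * (t : ℂ)))) atTop (𝓝 1) := by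
  refine ⟨isBigO_lommel ν, ?_⟩
  have h0 : Tendsto (fun t : ℝ => 1 / t) atTop (𝓝 0) := by simpa using tendsto_inv_atTop_zero
  have h := ((isBigO_lommel ν).trans_tendsto h0).add_const 1
  rw [zero_add] at h
  refine h.congr fun t => ?_
  rw [div_div_eq_mul_div]
  ring
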